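/- Let $(\Omega,\mathscr F,\mathbb P)$ be a probability space and let $(X,d)$ be a nonempty complete separable metric space with Borel $\sigma$-algebra $\mathscr B(X)$. A family of maps $S(t,s;\omega):X\to X$, $-\infty<s\le t<\infty$, $\omega\in\Omega$, is called a stochastic flow if for every $t\in\mathbb R$ and $x\in X$ the map $(s,\omega)\mapsto S(t,s;\omega)x$ is measurable from $((-\infty,t]\times\Omega,\mathscr B((-\infty,t])\otimes\mathscr F)$ to $(X,\mathscr B(X))$, and for $\mathbb P$-a.e. $\omega$ the following hold: $S(t,r;\omega)S(r,s;\omega)=S(t,s;\omega)$ for all $s\le r\le t$; $x\mapsto S(t,s;\omega)x$ is continuous for all $s\le t$; and $S(t,t;\omega)=\mathrm{id}_X$ for all $t$. For $A,B\subset X$ put $d(A,B)=\sup_{x\in A}\inf_{y\in B}d(x,y)\in[0,\infty]$. The flow is called asymptotically compact if there is a set $\Omega_0\in\mathscr F$ with $\mathbb P(\Omega_0)=1$ such that for all $t\in\mathbb R$ and $\omega\in\Omega_0$ there is a compact set $K(t,\omega)\subset X$ with $d(S(t,s;\omega)B,K(t,\omega))\to0$ as $s\to-\infty$ for every nonempty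 bounded $B\subset X$. Theorem. Every asymptotically compact stochastic flow $S$ admits an evolution system of measures, that is, a family $(\mu_s)_{s\in\mathbb R}$ of probability measures on $(\Omega\times X,\mathscr F\otimes\mathscr B(X))$, each with marginal $\mathbb P$ on $\Omega$, such that for all $s\le t$ the image of $\mu_s$ under the map $(\omega,x)\mapsto(\omega,S(t,s;\omega)x)$ equals $\mu_t$. -/

import Mathlib

open MeasureTheory Filter Topology Set

/-- A stochastic flow over the probability space `(Ω, P)` on the metric space `X`: maps
`S t s ω : X → X`, of which only those with `s ≤ t` matter. The algebraic and continuity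
properties hold for all times simultaneously, outside one `P`-null set of `ω`. -/
structure IsStochasticFlow {Ω X : Type*} [MeasurableSpace Ω] [MetricSpace X] [MeasurableSpace X]
    (P : Measure Ω) (S : ℝ → ℝ → Ω → X → X) : Prop where
  /-- `S(t,r;ω) S(r,s;ω) = S(t,s;ω)` for all `s ≤ r ≤ t`. -/
  comp : ∀ᵐ ω ∂P, ∀ s r t : ℝ, s ≤ r → r ≤ t → ∀ x : X, S t r ω (S r s ω x) = S t s ω x
  /-- `x ↦ S(t,s;ω) x` is continuous for all `s ≤ t`. -/
  continuous : ∀ᵐ ω ∂P, ∀ s t : ℝ, s ≤ t → Continuous (S t s ω)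
  /-- For all `t` and `x`, the map `(s, ω) ↦ S(t,s;ω) x` is measurable on `(-∞, t] × Ω`. -/
  measurable : ∀ (t : ℝ) (x : X), Measurable (fun p : Set.Iic t × Ω => S t (p.1 : ℝ) p.2 x)
  /-- `S(t,t;ω) = id` for all `t`. -/
  id : ∀ᵐ ω ∂P, ∀ (t : ℝ) (x : X), S t t ω x = x

/-- The semidistance `d(A, B) = sup_{x ∈ A} inf_{y ∈ B} d(x, y)`, with values in `[0, ∞]`
(so that `d(A, ∅) = ∞` for nonempty `A`). -/
noncomputable def semiDist {X : Type*} [MetricSpace X] (A B : Set X) : ENNReal :=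
  ⨆ x ∈ A, ⨅ y ∈ B, edist x y

/-- `K` is an attracting set at time `t` and sample point `ω`: for each nonempty bounded `B`,
`d(S(t,s;ω) B, K) → 0` as `s → -∞`. -/
def IsAttractingSet {Ω X : Type*} [MetricSpace X] (S : ℝ → ℝ → Ω → X → X) (t : ℝ) (ω : Ω)
    (K : Set X) : Prop :=
  ∀ B : Set X, B.Nonempty → Bornology.IsBounded B →
    Tendsto (fun s : ℝ => semiDist (S t s ω '' B) K) atBot (𝓝 0)

/-- Asymptotic compactness: on a measurable set of measure one, at every time there is a compact
attracting set. -/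
def IsAsymptoticallyCompact {Ω X : Type*} [MeasurableSpace Ω] [MetricSpace X]
    (P : Measure Ω) (S : ℝ → ℝ → Ω → X → X) : Prop :=
  ∃ Ω₀ : Set Ω, MeasurableSet Ω₀ ∧ P Ω₀ = 1 ∧
    ∀ t : ℝ, ∀ ω ∈ Ω₀, ∃ K : Set X, IsCompact K ∧ IsAttractingSet S t ω K

/-- An evolution system of measures for `S`: probability measures `μ s` on `Ω × X` with
`Ω`-marginal `P` such that the image of `μ s` under `(ω, x) ↦ (ω, S(t,s;ω) x)` is `μ t`, for all
`s ≤ t`. Since `μ t` is not the zero measure, the last equation also says that this map is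
almost everywhere measurable for `μ s`, i.e. that the image is meaningful. -/
structure IsEvolutionSystem {Ω X : Type*} [MeasurableSpace Ω] [MeasurableSpace X]
    (P : Measure Ω) (S : ℝ → ℝ → Ω → X → X) (μ : ℝ → Measure (Ω × X)) : Prop where
  isProbabilityMeasure : ∀ s : ℝ, IsProbabilityMeasure (μ s)
  marginal : ∀ s : ℝ, (μ s).map Prod.fst = P
  map_eq : ∀ s t : ℝ, s ≤ t → (μ s).map (fun p : Ω × X => (p.1, S t s p.1 p.2)) = μ t

/-! It suffices to find measurable `η t` with `S t s ω (η s ω) = η t ω` almost surely; the laws of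
`(ω, η t ω)` then form the system. For fixed ω, the pullbacks of one point `x₀` from time `-n` to
the times `-k` form a sequence in the product space `ℕ → X`. Attraction makes it relatively compact,
and any cluster point is a backward orbit because the orbit relations are closed conditions.
Measurability in ω comes from `exists_measurable_mapClusterPt`, which selects a cluster point
through shrinking balls. -/

section MeasurableSelection

variable {Ω Z : Type*} [MeasurableSpace Ω]

/-- Among the indices `n` with `ω ∈ E n`, infinitely many of the points `Y n ω` lie in one ball of
radius `r`, whose centre can be chosen measurably in `ω`. -/
theorem exists_measurable_frequently_dist_lt [PseudoMetricSpace Z]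
    [TopologicalSpace.SeparableSpace Z] [Nonempty Z] [MeasurableSpace Z] [BorelSpace Z]
    {Y : ℕ → Ω → Z} (hY : ∀ n, Measurable (Y n))
    (hK : ∀ ω, ∃ K : Set Z, IsCompact K ∧ ∀ n, Y n ω ∈ K)
    {E : ℕ → Set Ω} (hE : ∀ n, MeasurableSet (E n)) (hfreq : ∀ ω, ∃ᶠ n in atTop, ω ∈ E n)
    {r : ℝ} (hr : 0 < r) :
    ∃ c : Ω → Z, Measurable c ∧ ∀ ω, ∃ᶠ n in atTop, ω ∈ E n ∧ dist (Y n ω) (c ω) < r := by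
  classical
  have hex : ∀ ω, ∃ i : ℕ, ∃ᶠ n in atTop,
      ω ∈ E n ∧ dist (Y n ω) (TopologicalSpace.denseSeq Z i) < r := by
    intro ω
    obtain ⟨K, hKc, hYK⟩ := hK ω
    have : (atTop ⊓ 𝓟 {n | ω ∈ E n}).NeBot := frequently_mem_iff_neBot.1 (hfreq ω)
    obtain ⟨a, -, ha⟩ := hKc.exists_mapClusterPt (f := atTop ⊓ 𝓟 {n | ω ∈ E n})
      (u := fun n => Y n ω) (tendsto_principal.2 (Eventually.of_forall hYK))
    obtain ⟨i, hi⟩ := (TopologicalSpace.denseRange_denseSeq Z).exists_dist_lt a hr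
    refine ⟨i, ?_⟩
    have hev : ∀ᶠ y in 𝓝 a, dist y (TopologicalSpace.denseSeq Z i) < r :=
      (continuous_id.dist continuous_const).continuousAt.eventually_lt continuousAt_const hi
    have := ha.frequently hev
    rw [frequently_inf_principal] at this
    exact this
  -- Taking the first admissible dense point makes the choice measurable.
  refine ⟨fun ω => TopologicalSpace.denseSeq Z (Nat.find (hex ω)),
    (measurable_from_nat (f := TopologicalSpace.denseSeq Z)).comp (measurable_find hex fun i => ?_),
    fun ω => Nat.find_spec (hex ω)⟩
  have : {ω | ∃ᶠ n in atTop, ω ∈ E n ∧ dist (Y n ω) (TopologicalSpace.denseSeq Z i) < r} =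
      ⋂ N, ⋃ n, ⋃ (_ : N ≤ n), E n ∩ {ω | dist (Y n ω) (TopologicalSpace.denseSeq Z i) < r} := by
    ext ω
    simp only [frequently_atTop, mem_ofPred_eq, mem_iInter, mem_iUnion, mem_inter_iff, exists_prop]
  rw [this]
  exact .iInter fun N => .iUnion fun n => .iUnion fun _ =>
    (hE n).inter (measurableSet_lt ((hY n).dist measurable_const) measurable_const)

/-- A relatively compact sequence of measurable maps into a Polish space has a measurable
selection of cluster points. -/
theorem exists_measurable_mapClusterPt [TopologicalSpace Z] [PolishSpace Z] [Nonempty Z]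
    [MeasurableSpace Z] [BorelSpace Z] {Y : ℕ → Ω → Z} (hY : ∀ n, Measurable (Y n))
    (hK : ∀ ω, ∃ K : Set Z, IsCompact K ∧ ∀ n, Y n ω ∈ K) :
    ∃ ξ : Ω → Z, Measurable ξ ∧ ∀ ω, MapClusterPt (ξ ω) atTop (fun n => Y n ω) := by
  let _ := TopologicalSpace.upgradeIsCompletelyMetrizable Z
  let T := {E : ℕ → Set Ω // (∀ n, MeasurableSet (E n)) ∧ ∀ ω, ∃ᶠ n in atTop, ω ∈ E n}
  have hr : ∀ k : ℕ, 0 < (1 / 2 : ℝ) ^ k := fun k => by positivity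
  choose c hcm hcf using fun (E : T) (k : ℕ) =>
    exists_measurable_frequently_dist_lt hY hK E.2.1 E.2.2 (hr k)
  -- Keep only the indices whose point falls in the chosen ball; infinitely many survive for each ω.
  let next : ℕ → T → T := fun k E =>
    ⟨fun n => E.1 n ∩ {ω | dist (Y n ω) (c E k ω) < (1 / 2 : ℝ) ^ k},
      fun n => (E.2.1 n).inter (measurableSet_lt ((hY n).dist (hcm E k)) measurable_const),
      hcf E k⟩
  let F : ℕ → T := fun k =>
    Nat.rec ⟨fun _ => univ, fun _ => .univ, fun _ => (Eventually.of_forall mem_univ).frequently⟩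
      next k
  have hmem : ∀ k n ω, ω ∈ (F (k + 1)).1 n →
      ω ∈ (F k).1 n ∧ dist (Y n ω) (c (F k) k ω) < (1 / 2 : ℝ) ^ k := fun k n ω h => h
  have hdist : ∀ ω k, dist (c (F k) k ω) (c (F (k + 1)) (k + 1) ω) ≤ 2 * (1 / 2 : ℝ) ^ k := by
    intro ω k
    -- An index surviving both stages gives a point close to both centres.
    obtain ⟨n, hn⟩ := ((F (k + 2)).2.2 ω).exists
    obtain ⟨hn', h2⟩ := hmem (k + 1) _ _ hn
    have h1 := (hmem _ _ _ hn').2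
    have h3 : (1 / 2 : ℝ) ^ (k + 1) ≤ (1 / 2 : ℝ) ^ k :=
      pow_le_pow_of_le_one (by norm_num) (by norm_num) k.le_succ
    have := dist_triangle_left (c (F k) k ω) (c (F (k + 1)) (k + 1) ω) (Y n ω)
    linarith
  have hlim : ∀ ω, ∃ z, Tendsto (fun k => c (F k) k ω) atTop (𝓝 z) := fun ω =>
    cauchySeq_tendsto_of_complete (cauchySeq_of_le_geometric _ _ (by norm_num) (hdist ω))
  choose ξ hξ using hlim
  refine ⟨ξ, measurable_of_tendsto_metrizable (fun k => hcm (F k) k) (tendsto_pi_nhds.2 hξ),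
    fun ω => ?_⟩
  rw [Metric.nhds_basis_ball.mapClusterPt_iff_frequently]
  intro ε hε
  have h1 : ∀ᶠ k in atTop, dist (c (F k) k ω) (ξ ω) < ε / 2 :=
    (hξ ω).eventually (Metric.ball_mem_nhds _ (half_pos hε))
  have h2 : ∀ᶠ k : ℕ in atTop, (1 / 2 : ℝ) ^ k < ε / 2 :=
    (tendsto_pow_atTop_nhds_zero_of_lt_one (by norm_num) (by norm_num)).eventually_lt_const
      (half_pos hε)
  obtain ⟨k, hk1, hk2⟩ := (h1.and h2).exists
  refine ((F (k + 1)).2.2 ω).mono fun n hn => ?_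
  have := (hmem _ _ _ hn).2
  have := dist_triangle (Y n ω) (c (F k) k ω) (ξ ω)
  rw [Metric.mem_ball]
  linarith

end MeasurableSelection

/-- A sequence in a complete space that is attracted by a compact set is relatively compact. -/
theorem exists_isCompact_of_tendsto_infEDist {X : Type*} [MetricSpace X] [CompleteSpace X]
    {y : ℕ → X} {K : Set X} (hK : IsCompact K)
    (hy : Tendsto (fun n => Metric.infEDist (y n) K) atTop (𝓝 0)) :
    ∃ K' : Set X, IsCompact K' ∧ ∀ n, y n ∈ K' := by
  refine ⟨closure (range y), TotallyBounded.isCompact_of_isClosed (TotallyBounded.closure ?_)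
    isClosed_closure, fun n => subset_closure (mem_range_self n)⟩
  rw [EMetric.totallyBounded_iff]
  intro ε hε
  have hε2 : 0 < ε / 2 := ENNReal.half_pos hε.ne'
  obtain ⟨t, ht, hKt⟩ := EMetric.totallyBounded_iff.1 hK.totallyBounded _ hε2
  obtain ⟨N, hN⟩ := eventually_atTop.1 (hy.eventually_lt_const hε2)
  refine ⟨t ∪ y '' Iio N, ht.union ((finite_Iio N).image y), ?_⟩
  rintro _ ⟨n, rfl⟩
  rcases lt_or_ge n N with hn | hn
  · exact mem_biUnion (Or.inr (mem_image_of_mem y hn)) (Metric.mem_eball_self hε)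
  · obtain ⟨z, hz, hyz⟩ := Metric.infEDist_lt_iff.1 (hN n hn)
    obtain ⟨w, hw, hzw⟩ := mem_iUnion₂.1 (hKt hz)
    refine mem_biUnion (Or.inl hw) (lt_of_le_of_lt (edist_triangle _ z _) ?_)
    calc edist (y n) z + edist z w < ε / 2 + ε / 2 := ENNReal.add_lt_add hyz hzw
      _ = ε := ENNReal.add_halves ε

theorem infEDist_le_semiDist {X : Type*} [MetricSpace X] {A B : Set X} {x : X} (hx : x ∈ A) :
    Metric.infEDist x B ≤ semiDist A B :=
  le_iSup₂ (f := fun x (_ : x ∈ A) => ⨅ y ∈ B, edist x y) x hx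

/-- Along `s = -n`, the pullback orbits of a point are relatively compact. -/
theorem IsAttractingSet.exists_isCompact {Ω X : Type*} [MetricSpace X] [CompleteSpace X]
    {S : ℝ → ℝ → Ω → X → X} {t : ℝ} {ω : Ω} {K : Set X} (h : IsAttractingSet S t ω K)
    (hK : IsCompact K) (x : X) :
    ∃ K' : Set X, IsCompact K' ∧ ∀ n : ℕ, S t (-n) ω x ∈ K' := by
  refine exists_isCompact_of_tendsto_infEDist hK (tendsto_of_tendsto_of_tendsto_of_le_of_le
    tendsto_const_nhds ((h {x} (singleton_nonempty x) Bornology.isBounded_singleton).comp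
      (tendsto_neg_atTop_atBot.comp tendsto_natCast_atTop_atTop)) (fun _ => zero_le) fun n => ?_)
  exact infEDist_le_semiDist (mem_image_of_mem _ (mem_singleton x))

theorem IsStochasticFlow.measurable_apply {Ω X : Type*} [MeasurableSpace Ω] [MetricSpace X]
    [MeasurableSpace X] {P : Measure Ω} {S : ℝ → ℝ → Ω → X → X} (hS : IsStochasticFlow P S)
    {s t : ℝ} (hst : s ≤ t) (x : X) : Measurable fun ω => S t s ω x :=
  (hS.measurable t x).comp (measurable_const (a := (⟨s, hst⟩ : Iic t)) |>.prodMk measurable_id)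

/-- An asymptotically compact flow has measurable backward orbits `ξ` along the times
`0, -1, -2, …`. -/
theorem IsStochasticFlow.exists_measurable_orbit {Ω X : Type*} [MeasurableSpace Ω] {P : Measure Ω}
    [MetricSpace X] [CompleteSpace X] [TopologicalSpace.SeparableSpace X] [Nonempty X]
    [MeasurableSpace X] [BorelSpace X] {S : ℝ → ℝ → Ω → X → X} (hS : IsStochasticFlow P S)
    {M : Set Ω} (hM : MeasurableSet M)
    (hcomp : ∀ ω ∈ M, ∀ s r t : ℝ, s ≤ r → r ≤ t → ∀ x : X, S t r ω (S r s ω x) = S t s ω x)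
    (hcont : ∀ ω ∈ M, ∀ s t : ℝ, s ≤ t → Continuous (S t s ω))
    (hatt : ∀ ω ∈ M, ∀ t : ℝ, ∃ K : Set X, IsCompact K ∧ IsAttractingSet S t ω K) :
    ∃ ξ : ℕ → Ω → X, (∀ k, Measurable (ξ k)) ∧
      ∀ ω ∈ M, ∀ k m : ℕ, k ≤ m → S (-k) (-m) ω (ξ m ω) = ξ k ω := by
  classical
  obtain ⟨x₀⟩ := ‹Nonempty X›
  have : SecondCountableTopology X := UniformSpace.secondCountable_of_separable X
  -- All levels `k` share one sequence, so a single cluster point serves them all; `x₀` is filler.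
  let Y : ℕ → Ω → ℕ → X := fun n ω k =>
    if k ≤ n then M.piecewise (fun ω => S (-k) (-n) ω x₀) (fun _ => x₀) ω else x₀
  have hY : ∀ n, Measurable (Y n) := fun n => measurable_pi_lambda _ fun k => by
    by_cases hkn : k ≤ n
    · simp only [Y, hkn, if_true]
      exact (hS.measurable_apply (neg_le_neg (Nat.cast_le.2 hkn)) x₀).piecewise hM measurable_const
    · simp only [Y, hkn, if_false]
      exact measurable_const
  have hYM : ∀ ω ∈ M, ∀ {k n : ℕ}, k ≤ n → Y n ω k = S (-k) (-n) ω x₀ := fun ω hω k n hkn => by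
    simp [Y, hkn, hω]
  have hK : ∀ ω, ∃ K : Set (ℕ → X), IsCompact K ∧ ∀ n, Y n ω ∈ K := by
    intro ω
    have : ∀ k, ∃ K : Set X, IsCompact K ∧ ∀ n, Y n ω k ∈ K := by
      intro k
      by_cases hω : ω ∈ M
      · obtain ⟨K, hK, hKa⟩ := hatt ω hω (-k)
        obtain ⟨K', hK', h⟩ := hKa.exists_isCompact hK x₀
        refine ⟨insert x₀ K', hK'.insert x₀, fun n => ?_⟩
        by_cases hkn : k ≤ n
        · rw [hYM ω hω hkn]
          exact mem_insert_of_mem _ (h n)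
        · simp [Y, hkn]
      · exact ⟨{x₀}, isCompact_singleton, fun n => by simp [Y, hω]⟩
    choose K hK hYK using this
    exact ⟨univ.pi K, isCompact_univ_pi hK, fun n k _ => hYK k n⟩
  obtain ⟨ξ, hξm, hξ⟩ := exists_measurable_mapClusterPt hY hK
  refine ⟨fun k ω => ξ ω k, fun k => (measurable_pi_apply k).comp hξm, fun ω hω k m hkm => ?_⟩
  have hkm' : (-m : ℝ) ≤ -k := neg_le_neg (Nat.cast_le.2 hkm)
  have hclosed : IsClosed {z : ℕ → X | S (-k) (-m) ω (z m) = z k} :=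
    isClosed_eq ((hcont ω hω _ _ hkm').comp (continuous_apply m)) (continuous_apply k)
  refine hclosed.mem_of_mapClusterPt (hξ ω) ((eventually_ge_atTop m).mono fun n hn => ?_)
  rw [mem_ofPred_eq, hYM ω hω hn, hYM ω hω (hkm.trans hn)]
  exact hcomp ω hω _ _ _ (neg_le_neg (Nat.cast_le.2 hn)) hkm' x₀

theorem mainTheorem3 {Ω X : Type*} [MeasurableSpace Ω] (P : Measure Ω) [IsProbabilityMeasure P]
    [MetricSpace X] [CompleteSpace X] [TopologicalSpace.SeparableSpace X] [Nonempty X]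
    [MeasurableSpace X] [BorelSpace X]
    (S : ℝ → ℝ → Ω → X → X) (hS : IsStochasticFlow P S) (hc : IsAsymptoticallyCompact P S) :
    ∃ μ : ℝ → Measure (Ω × X), IsEvolutionSystem P S μ := by

  classical
  have : SecondCountableTopology X := UniformSpace.secondCountable_of_separable X
  obtain ⟨Ω₀, hΩ₀, hPΩ₀, hK⟩ := hc
  have hΩ₀' : ∀ᵐ ω ∂P, ω ∈ Ω₀ := (mem_ae_iff_prob_eq_one hΩ₀).2 hPΩ₀
  obtain ⟨M, hMae, hM, hgood⟩ :=
    (hS.comp.and (hS.continuous.and hΩ₀')).exists_measurable_mem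
  obtain ⟨ξ, hξm, hξ⟩ := hS.exists_measurable_orbit hM (fun ω hω => (hgood ω hω).1)
    (fun ω hω => (hgood ω hω).2.1) (fun ω hω t => hK t ω (hgood ω hω).2.2)
  -- `T t s` agrees with `S t s` on `M`, and is jointly measurable.
  let T : ℝ → ℝ → Ω → X → X := fun t s ω x => M.piecewise (fun ω => S t s ω x) (fun _ => x) ω
  have hTS : ∀ t s, ∀ ω ∈ M, T t s ω = S t s ω := fun t s ω hω => by
    ext x
    simp [T, hω]
  have hT : ∀ {s t : ℝ}, s ≤ t → Measurable fun p : Ω × X => T t s p.1 p.2 := by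
    intro s t hst
    -- Carathéodory: continuous in `x`, measurable in `ω`.
    refine (measurable_uncurry_of_continuous_of_measurable (u := fun x ω => T t s ω x)
      (fun ω => ?_) fun x => ?_).comp measurable_swap
    · by_cases hω : ω ∈ M
      · simpa [T, hω] using (hgood ω hω).2.1 s t hst
      · simpa [T, hω] using continuous_id'
    · exact (hS.measurable_apply hst x).piecewise hM measurable_const
  have hceil : ∀ t : ℝ, -(⌈-t⌉₊ : ℝ) ≤ t := fun t => neg_le.1 (Nat.le_ceil (-t))
  -- Flow forward from the latest of the times `0, -1, -2, …` not after `t`; for `t ≥ 0` this is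
  -- `0`.
  let η : ℝ → Ω → X := fun t ω => T t (-⌈-t⌉₊) ω (ξ ⌈-t⌉₊ ω)
  have hη : ∀ t, Measurable (η t) := fun t =>
    (hT (hceil t)).comp (measurable_id.prodMk (hξm _))
  have hηS : ∀ s t : ℝ, s ≤ t → ∀ ω ∈ M, S t s ω (η s ω) = η t ω := by
    intro s t hst ω hω
    have hcomp := (hgood ω hω).1
    have hle : ⌈-t⌉₊ ≤ ⌈-s⌉₊ := Nat.ceil_mono (neg_le_neg hst)
    simp only [η, hTS _ _ ω hω]
    rw [hcomp _ _ _ (hceil s) hst, ← hξ ω hω _ _ hle,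
      hcomp _ _ _ (neg_le_neg (Nat.cast_le.2 hle)) (hceil t)]
  have hgraph : ∀ t, Measurable fun ω => (ω, η t ω) := fun t => measurable_id.prodMk (hη t)
  refine ⟨fun t => P.map fun ω => (ω, η t ω),
    fun t => Measure.isProbabilityMeasure_map (hgraph t).aemeasurable, fun t => ?_,
    fun s t hst => ?_⟩
  · rw [Measure.map_map measurable_fst (hgraph t)]
    exact Measure.map_id
  -- Off `M`, `S` need not be jointly measurable, so `T` replaces it.
  · have hae : (fun p : Ω × X => (p.1, S t s p.1 p.2)) =ᵐ[P.map fun ω => (ω, η s ω)]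
        fun p => (p.1, T t s p.1 p.2) := by
      have : ∀ᵐ p ∂(P.map fun ω => (ω, η s ω)), p.1 ∈ M :=
        (ae_map_iff (hgraph s).aemeasurable (measurable_fst hM)).2 hMae
      filter_upwards [this] with p hp
      rw [hTS t s p.1 hp]
    rw [Measure.map_congr hae, Measure.map_map (measurable_fst.prodMk (hT hst)) (hgraph s)]
    refine Measure.map_congr ?_
    filter_upwards [hMae] with ω hω
    simp only [Function.comp_apply, hTS t s ω hω, hηS s t hst ω hω]
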